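/- Let $\mathbb{K}$ be a field, let $Q$ be a finite quiver with $n\ge 1$ vertices, let $J$ be the two-sided ideal of the path algebra $\mathbb{K}Q$ generated by the arrows, and let $A$ be a radical square zero algebra with quiver $Q$, that is, a $\mathbb{K}$-algebra isomorphic to $\mathbb{K}Q/J^2$. Paths are composed from left to right, and all modules are finitely generated right $A$-modules. Let $A_0=\mathbb{K}Q/J$, regarded as a right $A$-module; it is the direct sum of the simple $A$-modules, one from each isomorphism class. Let $K_0$ be the free abelian group on the isomorphism classes $[M]$ of $A$-modules modulo the relations $[M]-[M']-[M'']$ for $M\cong M'\oplus M''$ and $[P]$ for $P$ projective. For a module $M$ let $\Omega(M)$ be the kernel of a projective cover of $M$, let $\overline{\Omega}:K_0\to K_0$ be the group endomorphism with $\overline{\Omega}[M]=[\Omega(M)]$, and let $\langle \mathrm{add}\,M\rangle\subseteq K_0$ be the subgroup generated by the classes of the indecomposable direct summands of $M$. Put $$\phi(M)=\min\{\,l\in\mathbb{N} : \overline{\Omega}|_{\overline{\Omega}^{\,l+s}\langle \mathrm{add}\,M\rangle}\ \text{is injective for all } s\in\mathbb{N}\,\},\qquad \phi\dim(A)=\sup\{\phi(M)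 : M \text{ a finitely generated right } A\text{-module}\}.$$ Then $\phi(A_0)\le n-1$ and $\phi\dim(A)\le n$. -/

import Mathlib

universe u v w

open CategoryTheory

/-! ### Path algebras of finite quivers -/

section PathAlgebra

variable (K : Type u) (V : Type v) [Field K] [Quiver.{w} V]

/-- A path of the quiver `V`, with its source and its target. -/
abbrev QuiverPath : Type (max v w) := Σ i j : V, Quiver.Path i j

/-- The path algebra `K V`: the `K`-vector space whose basis is the set of all paths
(the paths of length zero included). -/
def PathAlgebra : Type (max u v w) := QuiverPath.{v, w} V →₀ K

namespace PathAlgebra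

noncomputable instance : AddCommGroup (PathAlgebra K V) :=
  inferInstanceAs (AddCommGroup (QuiverPath V →₀ K))

noncomputable instance : Module K (PathAlgebra K V) :=
  inferInstanceAs (Module K (QuiverPath V →₀ K))

variable {V} in
/-- The basis element of the path algebra given by a path. -/
noncomputable def ofPath {i j : V} (p : Quiver.Path i j) : PathAlgebra K V :=
  Finsupp.single (⟨i, j, p⟩ : QuiverPath V) (1 : K)

open Classical in
variable {V} in
/-- The product of two paths: `p` followed by `q` if `p` ends where `q` starts, and `0` otherwise. -/
noncomputable def pathMul (p q : QuiverPath V) : PathAlgebra K V :=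
  if h : q.1 = p.2.1 then ofPath K (p.2.2.comp (q.2.2.cast h rfl)) else 0

/-- The multiplication of the path algebra, the bilinear extension of the product of paths. -/
noncomputable def mulLin : PathAlgebra K V →ₗ[K] PathAlgebra K V →ₗ[K] PathAlgebra K V :=
  Finsupp.linearCombination K fun p : QuiverPath V =>
    (Finsupp.linearCombination K fun q : QuiverPath V => pathMul K p q :
      PathAlgebra K V →ₗ[K] PathAlgebra K V)

noncomputable instance : Mul (PathAlgebra K V) := ⟨fun a b => mulLin K V a b⟩

/-- The unit of the path algebra is the sum of the paths of length zero. -/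
noncomputable instance [Fintype V] : One (PathAlgebra K V) :=
  ⟨∑ i : V, ofPath K (Quiver.Path.nil : Quiver.Path i i)⟩

variable {K V}

theorem mul_def (a b : PathAlgebra K V) : a * b = mulLin K V a b := rfl

theorem one_def [Fintype V] :
    (1 : PathAlgebra K V) = ∑ i : V, ofPath K (Quiver.Path.nil : Quiver.Path i i) := rfl

theorem mulLin_ofPath {i j k l : V} (p : Quiver.Path i j) (q : Quiver.Path k l) :
    mulLin K V (ofPath K p) (ofPath K q) = pathMul K ⟨i, j, p⟩ ⟨k, l, q⟩ := by
  unfold mulLin ofPath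
  erw [Finsupp.linearCombination_single, one_smul, Finsupp.linearCombination_single, one_smul]

theorem ofPath_mul_ofPath {i j k : V} (p : Quiver.Path i j) (q : Quiver.Path j k) :
    ofPath K p * ofPath K q = ofPath K (p.comp q) := by
  rw [mul_def, mulLin_ofPath]; simp [pathMul]

theorem ofPath_mul_ofPath_of_ne {i j k l : V} (p : Quiver.Path i j) (q : Quiver.Path k l)
    (h : k ≠ j) : ofPath K p * ofPath K q = 0 := by
  rw [mul_def, mulLin_ofPath]; simp [pathMul, h]

/-- The paths span the path algebra. -/
theorem induction_on {P : PathAlgebra K V → Prop} (a : PathAlgebra K V)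
    (path : ∀ {i j : V} (p : Quiver.Path i j), P (ofPath K p))
    (zero : P 0) (add : ∀ x y, P x → P y → P (x + y)) (smul : ∀ (c : K) x, P x → P (c • x)) :
    P a := by
  have key : ∀ f : QuiverPath V →₀ K, P f := by
    intro f
    induction f using Finsupp.induction_linear with
    | zero => exact zero
    | add f g hf hg => exact add f g hf hg
    | single p c =>
      have h : (Finsupp.single p c : QuiverPath V →₀ K) = c • Finsupp.single p (1 : K) := by
        rw [Finsupp.smul_single, smul_eq_mul, mul_one]
      rw [h]
      exact smul c _ (path p.2.2)
  exact key a

theorem add_mul' (a b c : PathAlgebra K V) : (a + b) * c = a * c + b * c := by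
  simp only [mul_def, map_add, LinearMap.add_apply]

theorem mul_add' (a b c : PathAlgebra K V) : a * (b + c) = a * b + a * c := by
  simp only [mul_def, map_add]

theorem zero_mul' (a : PathAlgebra K V) : 0 * a = 0 := by
  simp only [mul_def, map_zero, LinearMap.zero_apply]

theorem mul_zero' (a : PathAlgebra K V) : a * 0 = 0 := by
  simp only [mul_def, map_zero]

theorem smul_mul' (r : K) (a b : PathAlgebra K V) : (r • a) * b = r • (a * b) := by
  simp only [mul_def, map_smul, LinearMap.smul_apply]

theorem mul_smul' (r : K) (a b : PathAlgebra K V) : a * (r • b) = r • (a * b) := by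
  simp only [mul_def, map_smul]

theorem mul_assoc' (a b c : PathAlgebra K V) : a * b * c = a * (b * c) := by
  induction a using induction_on with
  | zero => simp only [zero_mul']
  | add x y hx hy => simp only [add_mul', hx, hy]
  | smul r x hx => simp only [smul_mul', hx]
  | @path i j p =>
  induction b using induction_on with
  | zero => simp only [zero_mul', mul_zero']
  | add x y hx hy => simp only [add_mul', mul_add', hx, hy]
  | smul r x hx => simp only [smul_mul', mul_smul', hx]
  | @path k l q =>
  induction c using induction_on with
  | zero => simp only [mul_zero']
  | add x y hx hy => simp only [mul_add', hx, hy]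
  | smul r x hx => simp only [mul_smul', hx]
  | @path m n r =>
  by_cases h : k = j
  · subst h
    by_cases h' : m = l
    · subst h'
      simp only [ofPath_mul_ofPath, Quiver.Path.comp_assoc]
    · rw [ofPath_mul_ofPath, ofPath_mul_ofPath_of_ne _ _ h', ofPath_mul_ofPath_of_ne _ _ h',
        mul_zero']
  · rw [ofPath_mul_ofPath_of_ne _ _ h, zero_mul']
    by_cases h' : m = l
    · subst h'
      rw [ofPath_mul_ofPath, ofPath_mul_ofPath_of_ne _ _ h]
    · rw [ofPath_mul_ofPath_of_ne _ _ h', mul_zero']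

theorem one_mul' [Fintype V] (a : PathAlgebra K V) : 1 * a = a := by
  induction a using induction_on with
  | zero => simp only [mul_zero']
  | add x y hx hy => simp only [mul_add', hx, hy]
  | smul r x hx => simp only [mul_smul', hx]
  | @path i j p =>
  rw [one_def, mul_def, map_sum, LinearMap.sum_apply, Finset.sum_eq_single i]
  · rw [← mul_def, ofPath_mul_ofPath, Quiver.Path.nil_comp]
  · intro k _ hk
    rw [← mul_def, ofPath_mul_ofPath_of_ne _ _ (Ne.symm hk)]
  · simp

theorem mul_one' [Fintype V] (a : PathAlgebra K V) : a * 1 = a := by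
  induction a using induction_on with
  | zero => simp only [zero_mul']
  | add x y hx hy => simp only [add_mul', hx, hy]
  | smul r x hx => simp only [smul_mul', hx]
  | @path i j p =>
  rw [one_def, mul_def, map_sum, Finset.sum_eq_single j]
  · rw [← mul_def, ofPath_mul_ofPath, Quiver.Path.comp_nil]
  · intro k _ hk
    rw [← mul_def, ofPath_mul_ofPath_of_ne _ _ hk]
  · simp

noncomputable instance [Fintype V] : Ring (PathAlgebra K V) :=
  { (inferInstance : AddCommGroup (PathAlgebra K V)),
    (inferInstance : Mul (PathAlgebra K V)),
    (inferInstance : One (PathAlgebra K V)) with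
    left_distrib := mul_add'
    right_distrib := add_mul'
    zero_mul := zero_mul'
    mul_zero := mul_zero'
    mul_assoc := mul_assoc'
    one_mul := one_mul'
    mul_one := mul_one' }

noncomputable instance [Fintype V] : Algebra K (PathAlgebra K V) :=
  Algebra.ofModule smul_mul' mul_smul'

end PathAlgebra

variable [Fintype V]

/-- The ideal `J` of the path algebra: the two-sided ideal generated by the arrows. -/
noncomputable def arrowIdeal : Ideal (PathAlgebra K V) :=
  (TwoSidedIdeal.span
    {x : PathAlgebra K V | ∃ (i j : V) (α : i ⟶ j), x = PathAlgebra.ofPath K α.toPath}).asIdeal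

instance : (arrowIdeal K V).IsTwoSided := by unfold arrowIdeal; infer_instance

/-- The radical square zero algebra `K V / J ^ 2`. -/
abbrev RadSquareZero : Type (max u v w) := PathAlgebra K V ⧸ (arrowIdeal K V) ^ 2

variable {K V}

theorem ofPath_cons_mem_arrowIdeal {i j k : V} (p : Quiver.Path i j) (α : j ⟶ k) :
    PathAlgebra.ofPath K (p.cons α) ∈ arrowIdeal K V := by
  have h : PathAlgebra.ofPath K (p.cons α)
      = PathAlgebra.ofPath K p * PathAlgebra.ofPath K α.toPath := by
    rw [PathAlgebra.ofPath_mul_ofPath]; rfl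
  rw [h]
  apply Ideal.mul_mem_left
  unfold arrowIdeal
  rw [TwoSidedIdeal.mem_asIdeal]
  exact TwoSidedIdeal.subset_span ⟨j, k, α, rfl⟩

theorem ofPath_cons_cons_mem_arrowIdeal_sq {i j k l : V} (p : Quiver.Path i j) (α : j ⟶ k)
    (β : k ⟶ l) : PathAlgebra.ofPath K ((p.cons α).cons β) ∈ arrowIdeal K V ^ 2 := by
  have h : PathAlgebra.ofPath K ((p.cons α).cons β)
      = PathAlgebra.ofPath K (p.cons α) * PathAlgebra.ofPath K β.toPath := by
    rw [PathAlgebra.ofPath_mul_ofPath]; rfl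
  rw [h, Submodule.pow_succ, Submodule.pow_one]
  exact Ideal.mul_mem_mul (ofPath_cons_mem_arrowIdeal p α)
    (ofPath_cons_mem_arrowIdeal Quiver.Path.nil β)

/-- For a finite quiver the algebra `K V / J ^ 2` is finite dimensional. -/
theorem RadSquareZero.finite [∀ i j : V, Finite (i ⟶ j)] : Module.Finite K (RadSquareZero K V) := by
  let S : Set (RadSquareZero K V) :=
    Set.range (fun x : V ⊕ (Σ i j : V, (i ⟶ j)) =>
      Ideal.Quotient.mk (arrowIdeal K V ^ 2) (Sum.elim
        (fun i => PathAlgebra.ofPath K (Quiver.Path.nil : Quiver.Path i i))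
        (fun α => PathAlgebra.ofPath K α.2.2.toPath) x))
  refine (Module.finite_def (R := K) (M := RadSquareZero K V)).mpr
    ⟨(Set.finite_range _ : S.Finite).toFinset, ?_⟩
  rw [Set.Finite.coe_toFinset, eq_top_iff]
  rintro x -
  obtain ⟨a, rfl⟩ := Ideal.Quotient.mk_surjective x
  induction a using PathAlgebra.induction_on with
  | zero => rw [map_zero]; exact Submodule.zero_mem _
  | add x y hx hy => rw [map_add]; exact Submodule.add_mem _ hx hy
  | smul c x hx =>
    exact Submodule.smul_mem _ c hx
  | @path i j p =>
    cases p with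
    | nil => exact Submodule.subset_span ⟨Sum.inl i, rfl⟩
    | cons p α =>
      cases p with
      | nil => exact Submodule.subset_span ⟨Sum.inr ⟨_, _, α⟩, rfl⟩
      | cons p β =>
        rw [Ideal.Quotient.eq_zero_iff_mem.mpr (ofPath_cons_cons_mem_arrowIdeal_sq p β α)]
        exact Submodule.zero_mem _

/-- A radical square zero algebra is right artinian. -/
theorem isArtinianRing_op_of_equiv [∀ i j : V, Finite (i ⟶ j)] {A : Type*} [Ring A] [Algebra K A]
    (e : A ≃ₐ[K] RadSquareZero K V) : IsArtinianRing Aᵐᵒᵖ := by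
  have : Module.Finite K (RadSquareZero K V) := RadSquareZero.finite
  have : Module.Finite K A := Module.Finite.equiv e.symm.toLinearEquiv
  have : Module.Finite K Aᵐᵒᵖ := Module.Finite.equiv (MulOpposite.opLinearEquiv K)
  exact IsArtinianRing.of_finite K Aᵐᵒᵖ

end PathAlgebra

/-! ### Syzygies

Modules over a ring `R` are left modules; right modules over `A` are modules over `Aᵐᵒᵖ`. -/

section Syzygy

variable {R : Type u} [Ring R]

/-- A projective cover: a surjection from a projective module whose kernel is superfluous. -/
structure IsProjectiveCover {P M : Type u} [AddCommGroup P] [Module R P] [AddCommGroup M]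
    [Module R M] (p : P →ₗ[R] M) : Prop where
  projective : Module.Projective R P
  surjective : Function.Surjective p
  superfluous : ∀ N : Submodule R P, N ⊔ LinearMap.ker p = ⊤ → N = ⊤

/-- Over an artinian ring every finitely generated module has a finitely generated projective
cover. -/
theorem exists_isProjectiveCover [IsArtinianRing R] (M : FGModuleCat.{u} R) :
    ∃ (P : FGModuleCat.{u} R) (p : P →ₗ[R] M), IsProjectiveCover p := by
  obtain ⟨n, f, hf⟩ := Module.Finite.exists_fin' R M
  let S : Set (Submodule R (Fin n → R)) :=
    {Q | (∃ Q', IsCompl Q Q') ∧ Function.Surjective (f.domRestrict Q)}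
  have hS : S.Nonempty := by
    refine ⟨⊤, ⟨⊥, isCompl_top_bot⟩, fun m => ?_⟩
    obtain ⟨x, rfl⟩ := hf m
    exact ⟨⟨x, trivial⟩, rfl⟩
  obtain ⟨Q, ⟨⟨Q', hQ'⟩, hsurj⟩, hmin⟩ := IsArtinian.set_has_minimal S hS
  have hproj : Module.Projective R Q :=
    Module.Projective.of_split Q.subtype (Q.projectionOnto Q' hQ')
      (Submodule.projectionOnto_comp_subtype hQ')
  have hfin : Module.Finite R Q := inferInstance
  refine ⟨FGModuleCat.of R Q, f.domRestrict Q, hproj, hsurj, ?_⟩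
  intro N hN
  set p : Q →ₗ[R] M := f.domRestrict Q with hp
  have hNs : Function.Surjective (p.domRestrict N) := by
    intro m
    obtain ⟨x, rfl⟩ := hsurj m
    have hx : x ∈ N ⊔ LinearMap.ker p := by rw [hN]; trivial
    obtain ⟨y, hy, z, hz, rfl⟩ := Submodule.mem_sup.mp hx
    refine ⟨⟨y, hy⟩, ?_⟩
    rw [LinearMap.domRestrict_apply, map_add, LinearMap.mem_ker.mp hz, add_zero]
  obtain ⟨g, hg⟩ := Module.projective_lifting_property (p.domRestrict N) p hNs
  let h : Module.End R Q := N.subtype.comp g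
  have hph : ∀ x, p (h x) = p x := fun x => LinearMap.congr_fun hg x
  have hpow : ∀ (k : ℕ) x, p ((h ^ k) x) = p x := by
    intro k
    induction k with
    | zero => intro x; rfl
    | succ k ih => intro x; rw [pow_succ', Module.End.mul_apply, hph, ih]
  obtain ⟨k, hk⟩ := Filter.eventually_atTop.mp h.eventually_isCompl_ker_pow_range_pow
  have hc : IsCompl (LinearMap.ker (h ^ (k + 1))) (LinearMap.range (h ^ (k + 1))) :=
    hk (k + 1) (by omega)
  have hle : LinearMap.range (h ^ (k + 1)) ≤ N := by
    rintro _ ⟨x, rfl⟩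
    rw [pow_succ', Module.End.mul_apply]
    exact (g ((h ^ k) x)).2
  let T : Submodule R (Fin n → R) := (LinearMap.range (h ^ (k + 1))).map Q.subtype
  have hT : T ∈ S := by
    constructor
    · refine ⟨(LinearMap.ker (h ^ (k + 1))).map Q.subtype ⊔ Q', ?_⟩
      have h1 : T ⊔ (LinearMap.ker (h ^ (k + 1))).map Q.subtype = Q := by
        rw [← Submodule.map_sup, hc.symm.sup_eq_top, Submodule.map_top, Submodule.range_subtype]
      have h2 : T ⊓ (LinearMap.ker (h ^ (k + 1))).map Q.subtype = ⊥ := by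
        rw [← Submodule.map_inf _ Q.subtype_injective, hc.symm.inf_eq_bot, Submodule.map_bot]
      constructor
      · refine (disjoint_iff.mpr h2).disjoint_sup_right_of_disjoint_sup_left ?_
        rw [h1]
        exact hQ'.disjoint
      · rw [codisjoint_iff, ← sup_assoc, h1, hQ'.sup_eq_top]
    · intro m
      obtain ⟨x, rfl⟩ := hsurj m
      exact ⟨⟨((h ^ (k + 1)) x : Q), ⟨_, ⟨x, rfl⟩, rfl⟩⟩, hpow (k + 1) x⟩
  have hTQ : T ≤ Q := by
    rintro _ ⟨y, _, rfl⟩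
    exact y.2
  have hTQ' : ¬ T < Q := hmin T hT
  have hQT : Q ≤ T := by
    by_contra hcon
    exact hTQ' (lt_of_le_not_ge hTQ hcon)
  rw [eq_top_iff]
  rintro x -
  obtain ⟨y, hy, hyx⟩ := hQT x.2
  have : y = x := Subtype.ext hyx
  exact hle (this ▸ hy)

/-- The syzygy `Ω M` of a finitely generated module: the kernel of a projective cover of `M`
(unique up to isomorphism). -/
noncomputable def syzygy [IsArtinianRing R] (M : FGModuleCat.{u} R) : FGModuleCat.{u} R :=
  FGModuleCat.of R (LinearMap.ker (exists_isProjectiveCover M).choose_spec.choose)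

/-- Schanuel's lemma. -/
theorem schanuel {P Q M : Type u} [AddCommGroup P] [Module R P] [AddCommGroup Q] [Module R Q]
    [AddCommGroup M] [Module R M] [Module.Projective R P] [Module.Projective R Q]
    (p : P →ₗ[R] M) (q : Q →ₗ[R] M) (hp : Function.Surjective p) (hq : Function.Surjective q) :
    Nonempty ((LinearMap.ker p × Q) ≃ₗ[R] (LinearMap.ker q × P)) := by
  obtain ⟨g, hg⟩ := Module.projective_lifting_property p q hp
  obtain ⟨h, hh⟩ := Module.projective_lifting_property q p hq
  have hg' : ∀ x, p (g x) = q x := fun x => LinearMap.congr_fun hg x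
  have hh' : ∀ x, q (h x) = p x := fun x => LinearMap.congr_fun hh x
  let F : (LinearMap.ker p × Q) →ₗ[R] (LinearMap.ker q × P) :=
    LinearMap.prod
      (LinearMap.codRestrict (LinearMap.ker q)
        (LinearMap.snd R _ _ - h ∘ₗ ((LinearMap.ker p).subtype.coprod g))
        (by intro x; simp [hg', hh']))
      ((LinearMap.ker p).subtype.coprod g)
  let G : (LinearMap.ker q × P) →ₗ[R] (LinearMap.ker p × Q) :=
    LinearMap.prod
      (LinearMap.codRestrict (LinearMap.ker p)
        (LinearMap.snd R _ _ - g ∘ₗ ((LinearMap.ker q).subtype.coprod h))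
        (by intro x; simp [hg', hh']))
      ((LinearMap.ker q).subtype.coprod h)
  refine ⟨LinearEquiv.ofLinearMap F G ?_ ?_⟩
  · ext x <;> simp [F, G]
  · ext x <;> simp [F, G]

end Syzygy

/-! ### The group `K₀` and the Igusa–Todorov function -/

section IgusaTodorov

variable (R : Type u) [Ring R]

/-- The relations of `K₀`: `[M] - [M'] - [M'']` whenever `M ≅ M' ⊕ M''`, and `[P]` for `P`
projective. (The first kind, together with `[0]`, identifies isomorphic modules.) -/
inductive K0Rel : FreeAbelianGroup (FGModuleCat.{u} R) → Prop
  | sum (M M' M'' : FGModuleCat.{u} R) (e : M ≃ₗ[R] (M' × M'')) :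
      K0Rel (FreeAbelianGroup.of M - FreeAbelianGroup.of M' - FreeAbelianGroup.of M'')
  | projective (P : FGModuleCat.{u} R) (h : Module.Projective R P) :
      K0Rel (FreeAbelianGroup.of P)

/-- The group `K₀`: generated by the finitely generated `R`-modules, modulo direct sums and
projective modules. -/
abbrev K0 : Type (u + 1) :=
  FreeAbelianGroup (FGModuleCat.{u} R) ⧸ AddSubgroup.closure {x | K0Rel R x}

variable {R}

/-- The class `[M]` in `K₀`. -/
def K0.mk (M : FGModuleCat.{u} R) : K0 R :=
  QuotientAddGroup.mk (FreeAbelianGroup.of M)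

theorem K0.mk_projective (P : FGModuleCat.{u} R) (h : Module.Projective R P) : K0.mk P = 0 :=
  (QuotientAddGroup.eq_zero_iff _).mpr (AddSubgroup.subset_closure (K0Rel.projective P h))

theorem K0.mk_sum (M M' M'' : FGModuleCat.{u} R) (e : M ≃ₗ[R] (M' × M'')) :
    K0.mk M = K0.mk M' + K0.mk M'' := by
  have h : (QuotientAddGroup.mk (FreeAbelianGroup.of M - FreeAbelianGroup.of M'
      - FreeAbelianGroup.of M'') : K0 R) = 0 :=
    (QuotientAddGroup.eq_zero_iff _).mpr (AddSubgroup.subset_closure (K0Rel.sum M M' M'' e))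
  rw [QuotientAddGroup.mk_sub, QuotientAddGroup.mk_sub, sub_sub, sub_eq_zero] at h
  exact h

theorem K0.mk_equiv (M N : FGModuleCat.{u} R) (e : M ≃ₗ[R] N) : K0.mk M = K0.mk N := by
  rw [K0.mk_sum M N (FGModuleCat.of R PUnit) (e.trans (LinearEquiv.prodUnique).symm),
    K0.mk_projective (FGModuleCat.of R PUnit) inferInstance, add_zero]

/-- The class in `K₀` of the kernel of a surjection from a projective module onto `M` depends only
on `M`. -/
theorem K0.mk_ker_eq [IsNoetherianRing R] {P Q M : Type u} [AddCommGroup P] [Module R P]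
    [AddCommGroup Q] [Module R Q] [AddCommGroup M] [Module R M] [Module.Finite R P]
    [Module.Finite R Q] [Module.Projective R P] [Module.Projective R Q]
    (p : P →ₗ[R] M) (q : Q →ₗ[R] M) (hp : Function.Surjective p) (hq : Function.Surjective q) :
    K0.mk (FGModuleCat.of R (LinearMap.ker p)) = K0.mk (FGModuleCat.of R (LinearMap.ker q)) := by
  obtain ⟨e⟩ := schanuel p q hp hq
  have h1 := K0.mk_sum (FGModuleCat.of R (LinearMap.ker p × Q))
    (FGModuleCat.of R (LinearMap.ker p)) (FGModuleCat.of R Q) (LinearEquiv.refl R _)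
  have h2 := K0.mk_sum (FGModuleCat.of R (LinearMap.ker p × Q))
    (FGModuleCat.of R (LinearMap.ker q)) (FGModuleCat.of R P) e
  rw [K0.mk_projective (FGModuleCat.of R Q) ‹_›, add_zero] at h1
  rw [K0.mk_projective (FGModuleCat.of R P) ‹_›, add_zero] at h2
  exact h1.symm.trans h2

variable [IsArtinianRing R]

/-- The class of the syzygy may be computed with any finitely generated projective module mapping
onto `M`. -/
theorem K0.mk_syzygy_eq (M : FGModuleCat.{u} R) {Q : Type u} [AddCommGroup Q] [Module R Q]
    [Module.Finite R Q] [Module.Projective R Q] (q : Q →ₗ[R] M) (hq : Function.Surjective q) :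
    K0.mk (syzygy M) = K0.mk (FGModuleCat.of R (LinearMap.ker q)) := by
  have hc := (exists_isProjectiveCover M).choose_spec.choose_spec
  have := hc.projective
  exact K0.mk_ker_eq _ q hc.surjective hq

theorem K0.mk_syzygy_projective (P : FGModuleCat.{u} R) (h : Module.Projective R P) :
    K0.mk (syzygy P) = 0 := by
  rw [K0.mk_syzygy_eq P (LinearMap.id : P →ₗ[R] P) Function.surjective_id]
  apply K0.mk_projective
  rw [LinearMap.ker_id]
  infer_instance

theorem K0.mk_syzygy_sum (M M' M'' : FGModuleCat.{u} R) (e : M ≃ₗ[R] (M' × M'')) :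
    K0.mk (syzygy M) = K0.mk (syzygy M') + K0.mk (syzygy M'') := by
  obtain ⟨P, p, hp⟩ := exists_isProjectiveCover M'
  obtain ⟨Q, q, hq⟩ := exists_isProjectiveCover M''
  have := hp.projective
  have := hq.projective
  have hs : Function.Surjective (e.symm.toLinearMap ∘ₗ p.prodMap q) :=
    e.symm.surjective.comp (Function.Surjective.prodMap hp.surjective hq.surjective)
  rw [K0.mk_syzygy_eq M' p hp.surjective, K0.mk_syzygy_eq M'' q hq.surjective,
    K0.mk_syzygy_eq M _ hs]
  apply K0.mk_sum
  have h1 : ∀ x : P × Q, (e.symm.toLinearMap ∘ₗ p.prodMap q) x = 0 ↔ p x.1 = 0 ∧ q x.2 = 0 := by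
    intro x
    simp [Prod.ext_iff]
  exact
    { toFun := fun x => (⟨x.1.1, ((h1 x.1).mp x.2).1⟩, ⟨x.1.2, ((h1 x.1).mp x.2).2⟩)
      invFun := fun y => ⟨(y.1.1, y.2.1), (h1 _).mpr ⟨y.1.2, y.2.2⟩⟩
      map_add' := fun _ _ => rfl
      map_smul' := fun _ _ => rfl
      left_inv := fun _ => rfl
      right_inv := fun _ => rfl }

variable (R) in
/-- The endomorphism `Ω̄` of `K₀` induced by the syzygy: `Ω̄ [M] = [Ω M]`. -/
noncomputable def omegaBar : K0 R →+ K0 R :=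
  QuotientAddGroup.lift _ (FreeAbelianGroup.lift fun M => K0.mk (syzygy M)) (by
    rw [AddSubgroup.closure_le]
    rintro x (⟨M, M', M'', e⟩ | ⟨P, h⟩)
    · simp [K0.mk_syzygy_sum M M' M'' e]
    · simp [K0.mk_syzygy_projective P h])

theorem omegaBar_mk (M : FGModuleCat.{u} R) : omegaBar R (K0.mk M) = K0.mk (syzygy M) := by
  simp [omegaBar, K0.mk]

/-- An indecomposable module: nonzero, and not the direct sum of two nonzero submodules. -/
def IsIndecomposableModule {R : Type u} [Ring R] (N : FGModuleCat.{u} R) : Prop :=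
  Nontrivial N ∧ ∀ X Y : Submodule R N, IsCompl X Y → X = ⊥ ∨ Y = ⊥

/-- `N` is (isomorphic to) a direct summand of `M`. -/
def IsDirectSummandOf {R : Type u} [Ring R] (N M : FGModuleCat.{u} R) : Prop :=
  ∃ N' : FGModuleCat.{u} R, Nonempty (M ≃ₗ[R] (N × N'))

/-- The subgroup `⟨add M⟩` of `K₀`, generated by the classes of the indecomposable direct summands
of `M`. -/
def addSpan {R : Type u} [Ring R] (M : FGModuleCat.{u} R) : AddSubgroup (K0 R) :=
  AddSubgroup.closure
    {x | ∃ N : FGModuleCat.{u} R, IsIndecomposableModule N ∧ IsDirectSummandOf N M ∧ x = K0.mk N}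

/-- The Igusa–Todorov function: `φ(M)` is the least `l` such that `Ω̄` is injective on
`Ω̄ ^ (l + s) ⟨add M⟩` for every `s` (and `⊤` if there were no such `l`). -/
noncomputable def igusaTodorovPhi (M : FGModuleCat.{u} R) : ℕ∞ :=
  ⨅ (l : ℕ) (_ : ∀ s : ℕ, Set.InjOn (omegaBar R)
    ((omegaBar R)^[l + s] '' (addSpan M : Set (K0 R)))), (l : ℕ∞)

variable (R) in
/-- The `φ`-dimension: the supremum of `φ(M)` over the finitely generated modules `M`. -/
noncomputable def phiDim : ℕ∞ :=
  ⨆ M : FGModuleCat.{u} R, igusaTodorovPhi M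

end IgusaTodorov

/-! ### The semisimple module `A₀` -/

section SemisimpleModule

variable {K : Type*} {V : Type*} [Field K] [Quiver V] [Fintype V] {A : Type u} [Ring A]
  [Algebra K A]

/-- The projection `A ≅ K V / J ^ 2 → K V / J`. -/
noncomputable def projToVertices (e : A ≃ₐ[K] RadSquareZero K V) :
    A →+* PathAlgebra K V ⧸ arrowIdeal K V :=
  (Ideal.Quotient.factor (Ideal.pow_le_self two_ne_zero)).comp (e : A →+* RadSquareZero K V)

/-- The right `A`-module `A₀ = K V / J`, written as the quotient of the regular right module `A` by
the kernel of the projection `A → K V / J`. It is the direct sum of all simple right `A`-modules,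
each taken once. -/
noncomputable def semisimpleModule (e : A ≃ₐ[K] RadSquareZero K V) : FGModuleCat.{u} Aᵐᵒᵖ :=
  FGModuleCat.of Aᵐᵒᵖ (Aᵐᵒᵖ ⧸ RingHom.ker (projToVertices e).op)

end SemisimpleModule

/-! ### Stabilisation of the kernels of the powers of an endomorphism -/

section KernelStabilisation

variable {F E : Type*} [Field F] [AddCommGroup E] [Module F E] [FiniteDimensional F E]

/-! Write `J` for the radical of `A`, so that `J² = 0`. The kernel of a projective cover `P → M` is
superfluous, hence has coordinates in `J` once `P` is embedded in a free module; it is therefore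
killed by `J` and is a sum of simple modules (`annihilates_ker`, `Annihilates.exists_mk_eq_sum`). So
`Ω̄` maps all of `K₀` into the subgroup `S` spanned by the classes of the simple modules.

The group `S` is free on the nonprojective simples. This needs no Krull–Schmidt theorem: the
multiplicity of a nonprojective simple as a direct summand is additive and vanishes on projectives,
so it is a functional on `K₀`, and these functionals separate the basis (`ofVector_injective`). In
this basis `Ω̄` is an integer matrix `C`.

What remains is linear algebra: the kernels of the powers of `C` must be constant from exponent `n -
1` on. If some simple is projective, `C` has at most `n - 1` rows and the dimension bound suffices.
Otherwise `C` is a nonnegative `n × n` matrix, and no row is zero because a nonprojective simple has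
a nonzero syzygy. Such a matrix is not nilpotent, whereas kernels still growing at exponent `n - 1`
would force `C ^ n = 0`.

Hence `Ω̄` is injective on `Ω̄ ^ k S` for `k ≥ n - 1`. The group `⟨add A₀⟩` lies in `S`, which gives
`n - 1`; for arbitrary `M` only `Ω̄ ⟨add M⟩` lies in `S`, which costs one more step. -/

theorem le_finrank_ker_pow_succ {f : Module.End F E} {m : ℕ}
    (h : LinearMap.ker (f ^ m) ≠ LinearMap.ker (f ^ (m + 1))) :
    m + 1 ≤ Module.finrank F (LinearMap.ker (f ^ (m + 1))) := by
  have hle : ∀ k, LinearMap.ker (f ^ k) ≤ LinearMap.ker (f ^ (k + 1)) := fun k x hx => by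
    rw [LinearMap.mem_ker] at hx ⊢
    rw [pow_succ', Module.End.mul_apply, hx, map_zero]
  -- Once two consecutive kernels agree the chain is constant, so a strict step at `m` forces all
  -- earlier steps to be strict; each raises the dimension by at least one.
  have hlt : ∀ k ≤ m, LinearMap.ker (f ^ k) < LinearMap.ker (f ^ (k + 1)) := by
    intro k hk
    refine lt_of_le_of_ne (hle k) fun hkk => h ?_
    obtain ⟨d, rfl⟩ := Nat.exists_eq_add_of_le hk
    have h1 := Module.End.ker_pow_constant hkk d
    have h2 := Module.End.ker_pow_constant hkk (d + 1)
    rw [add_assoc, ← h1, ← h2]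
  have key : ∀ k ≤ m + 1, k ≤ Module.finrank F (LinearMap.ker (f ^ k)) := by
    intro k
    induction k with
    | zero => intro _; exact Nat.zero_le _
    | succ k ih =>
      intro hk
      have h1 := Submodule.finrank_lt_finrank_of_lt (hlt k (by omega))
      have h2 := ih (by omega)
      omega
  exact key _ le_rfl

/-- If the kernels still grew from exponent `n` to `n + 1`, the last one would have dimension at
least `n + 1`, hence be all of `E`, and `f ^ (n + 1)` would vanish in dimension exactly `n + 1`. In
the application `n` is the number of vertices minus one. -/
theorem ker_pow_eq_of_not_nilpotent {f : Module.End F E} {n k : ℕ}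
    (hn : Module.finrank F E ≤ n + 1) (hf : Module.finrank F E = n + 1 → f ^ (n + 1) ≠ 0)
    (hk : n ≤ k) : LinearMap.ker (f ^ k) = LinearMap.ker (f ^ (k + 1)) := by
  have h : LinearMap.ker (f ^ n) = LinearMap.ker (f ^ (n + 1)) := by
    by_contra hcon
    have h1 := le_finrank_ker_pow_succ hcon
    have h2 := Submodule.finrank_le (LinearMap.ker (f ^ (n + 1)))
    refine hf (le_antisymm hn (h1.trans h2)) ?_
    rw [← LinearMap.ker_eq_top]
    exact Submodule.eq_top_of_finrank_eq (by omega)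
  obtain ⟨d, rfl⟩ := Nat.exists_eq_add_of_le hk
  have h1 := Module.End.ker_pow_constant h d
  have h2 := Module.End.ker_pow_constant h (d + 1)
  rw [add_assoc, ← h1, ← h2]

end KernelStabilisation

/-! ### Nonnegative integer matrices are not nilpotent without a zero row -/

section NonnegativeMatrix

variable {W : Type*} [Fintype W]

/-- If no row of a nonnegative matrix vanishes, then its iterates keep nonnegative nonzero vectors
nonnegative and nonzero. -/
theorem Matrix.iterate_vecMul_pos {C : Matrix W W ℤ} (h0 : ∀ i j, 0 ≤ C i j)
    (hpos : ∀ i, ∃ j, 0 < C i j) (k : ℕ) {x : W → ℤ} (hx : 0 < x) :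
    0 < (fun y => Matrix.vecMul y C)^[k] x := by
  induction k with
  | zero => exact hx
  | succ k ih =>
    rw [Function.iterate_succ_apply']
    set y := (fun y => Matrix.vecMul y C)^[k] x
    obtain ⟨hy, i, hi⟩ := Pi.lt_def.mp ih
    obtain ⟨j, hj⟩ := hpos i
    refine Pi.lt_def.mpr ⟨fun j => Finset.sum_nonneg fun i _ => mul_nonneg (hy i) (h0 i j), j, ?_⟩
    exact Finset.sum_pos' (fun i _ => mul_nonneg (hy i) (h0 i j))
      ⟨i, Finset.mem_univ i, mul_pos hi hj⟩

/-- The kernels of the iterates of an integer matrix with at most `n + 1` rows do not grow beyond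
the exponent `n`, provided that, if there are exactly `n + 1` rows, the matrix is nonnegative
without zero rows. -/
theorem Matrix.iterate_vecMul_eq_zero {C : Matrix W W ℤ} {n k : ℕ}
    (hn : Fintype.card W ≤ n + 1)
    (hC : Fintype.card W = n + 1 → (∀ i j, 0 ≤ C i j) ∧ ∀ i, ∃ j, 0 < C i j)
    (hk : n ≤ k) {x : W → ℤ} (hx : (fun y => Matrix.vecMul y C)^[k + 1] x = 0) :
    (fun y => Matrix.vecMul y C)^[k] x = 0 := by
  -- Dimensions are counted over `ℚ`; the cast is injective, so the vanishing of an integer vector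
  -- can be tested there.
  let c : (W → ℤ) → (W → ℚ) := fun x i => (x i : ℚ)
  let T : Module.End ℚ (W → ℚ) := (C.map (Int.castRingHom ℚ)).vecMulLinear
  have hcT : ∀ x, c (Matrix.vecMul x C) = T (c x) := fun x => by
    ext i
    exact RingHom.map_vecMul (Int.castRingHom ℚ) C x i
  have hc : ∀ k x, c ((fun y => Matrix.vecMul y C)^[k] x) = (T ^ k) (c x) := by
    intro k x
    induction k with
    | zero => rfl
    | succ k ih =>
      rw [Function.iterate_succ_apply', hcT, ih, pow_succ', Module.End.mul_apply]
  have hc0 : ∀ x, c x = 0 ↔ x = 0 := fun x => by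
    simp [c, funext_iff]
  have hker := ker_pow_eq_of_not_nilpotent (f := T) (n := n) (k := k)
    (by rwa [Module.finrank_fintype_fun_eq_card]) (by
      rw [Module.finrank_fintype_fun_eq_card]
      intro hcard hT
      obtain ⟨h0, hpos⟩ := hC hcard
      have : Nonempty W := Fintype.card_pos_iff.mp (by omega)
      -- The all-ones vector witnesses that the power `n + 1` is nonzero.
      have h1 : (0 : W → ℤ) < 1 := zero_lt_one
      have h2 := Matrix.iterate_vecMul_pos h0 hpos (n + 1) h1
      refine h2.ne' ((hc0 _).mp ?_)
      rw [hc, hT, LinearMap.zero_apply]) hk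
  rw [← hc0, hc, ← LinearMap.mem_ker] at hx ⊢
  rwa [hker]

end NonnegativeMatrix

/-! ### Multiplicities of a simple module as a direct summand -/

section Multiplicity

variable {R : Type u} [Ring R] {K : Type*} [Field K]

/-- The simple module `R ⧸ ker χ` given by a character `χ` of `R`. -/
abbrev CharModule (χ : R →+* K) : Type u := R ⧸ RingHom.ker χ

theorem CharModule.isSimpleModule {χ : R →+* K} (hχ : Function.Surjective χ) :
    IsSimpleModule R (CharModule χ) :=
  isSimpleModule_iff_isCoatom.mpr (RingHom.ker_isMaximal_of_surjective χ hχ).out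

/-- The elements of `M` on which `R` acts through the character `χ`. -/
def charSocle (χ : R →+* K) (M : Type*) [AddCommGroup M] [Module R M] : Submodule R M where
  carrier := {m | ∀ r, χ r = 0 → r • m = 0}
  zero_mem' := fun _ _ => smul_zero _
  add_mem' := fun ha hb r hr => by rw [smul_add, ha r hr, hb r hr, add_zero]
  smul_mem' := fun c m hm r hr => by
    rw [← mul_smul]
    exact hm _ (by rw [map_mul, hr, zero_mul])

/-- The elements of `M` annihilated by all homomorphisms to the simple module of `χ`. -/
def charRadical (χ : R →+* K) (M : Type*) [AddCommGroup M] [Module R M] : Submodule R M where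
  carrier := {m | ∀ f : M →ₗ[R] CharModule χ, f m = 0}
  zero_mem' := fun f => map_zero f
  add_mem' := fun ha hb f => by rw [map_add, ha f, hb f, add_zero]
  smul_mem' := fun c m hm f => by rw [map_smul, hm f, smul_zero]

/-- The multiplicity of the simple module of `χ` as a direct summand of `M`. -/
noncomputable def charMultiplicity (χ : R →+* K) (M : Type*) [AddCommGroup M] [Module R M] : ℤ :=
  (Module.length R (charSocle χ M)).toNat -
    (Module.length R (charSocle χ M ⊓ charRadical χ M : Submodule R M)).toNat

/-- The homomorphism from the simple module of `χ` given by an element of `charSocle χ M`. -/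
def CharModule.lift (χ : R →+* K) {M : Type*} [AddCommGroup M] [Module R M] {m : M}
    (hm : m ∈ charSocle χ M) : CharModule χ →ₗ[R] M :=
  Submodule.liftQ (RingHom.ker χ) (LinearMap.toSpanSingleton R M m) fun r hr => hm r hr

theorem CharModule.lift_mk_one (χ : R →+* K) {M : Type*} [AddCommGroup M] [Module R M] {m : M}
    (hm : m ∈ charSocle χ M) :
    CharModule.lift χ hm (Submodule.Quotient.mk (p := RingHom.ker χ) 1) = m :=
  one_smul R m

theorem CharModule.smul_eq_zero {χ : R →+* K} {r : R} (hr : χ r = 0) (x : CharModule χ) :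
    r • x = 0 := by
  obtain ⟨s, rfl⟩ := Submodule.Quotient.mk_surjective _ x
  rw [← Submodule.Quotient.mk_smul, Submodule.Quotient.mk_eq_zero, RingHom.mem_ker, smul_eq_mul,
    map_mul, hr, zero_mul]

variable (R) in
theorem length_toNat_of_prod {M N L : Type*} [AddCommGroup M] [Module R M] [AddCommGroup N]
    [Module R N] [AddCommGroup L] [Module R L] [IsArtinian R N] [IsNoetherian R N]
    [IsArtinian R L] [IsNoetherian R L] {X : Submodule R M} {Y : Submodule R N}
    {Z : Submodule R L} (e : M ≃ₗ[R] (N × L))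
    (h : ∀ m, m ∈ X ↔ (e m).1 ∈ Y ∧ (e m).2 ∈ Z) :
    (Module.length R X).toNat = (Module.length R Y).toNat + (Module.length R Z).toNat := by
  let f : X ≃ₗ[R] (Y × Z) :=
    { toFun := fun x => (⟨(e x.1).1, ((h x.1).mp x.2).1⟩, ⟨(e x.1).2, ((h x.1).mp x.2).2⟩)
      invFun := fun y => ⟨e.symm (y.1.1, y.2.1), (h _).mpr (by simp)⟩
      map_add' := fun a b => by ext <;> simp
      map_smul' := fun a b => by ext <;> simp
      left_inv := fun x => by ext; simp
      right_inv := fun y => by ext <;> simp }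
  rw [f.length_eq, Module.length_prod, ENat.toNat_add Module.length_ne_top Module.length_ne_top]

/-- `charSocle` and `charRadical` are both computed componentwise in a direct sum, so the lengths
add. Finite length matters because `toNat` is additive only on finite values. -/
theorem charMultiplicity_of_prod (χ : R →+* K) {M N L : Type*} [AddCommGroup M] [Module R M]
    [AddCommGroup N] [Module R N] [AddCommGroup L] [Module R L] [IsArtinian R N]
    [IsNoetherian R N] [IsArtinian R L] [IsNoetherian R L] (e : M ≃ₗ[R] (N × L)) :
    charMultiplicity χ M = charMultiplicity χ N + charMultiplicity χ L := by
  have h1 : ∀ m, m ∈ charSocle χ M ↔ (e m).1 ∈ charSocle χ N ∧ (e m).2 ∈ charSocle χ L := by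
    intro m
    constructor
    · intro hm
      have h : ∀ r, χ r = 0 → r • e m = 0 := fun r hr => by rw [← map_smul, hm r hr, map_zero]
      exact ⟨fun r hr => congrArg Prod.fst (h r hr), fun r hr => congrArg Prod.snd (h r hr)⟩
    · rintro ⟨ha, hb⟩ r hr
      apply e.injective
      rw [map_smul, map_zero]
      exact Prod.ext (ha r hr) (hb r hr)
  have h2 : ∀ m, m ∈ charRadical χ M ↔
      (e m).1 ∈ charRadical χ N ∧ (e m).2 ∈ charRadical χ L := by
    intro m
    constructor
    · intro hm
      exact ⟨fun f => hm (f ∘ₗ LinearMap.fst R N L ∘ₗ e.toLinearMap),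
        fun f => hm (f ∘ₗ LinearMap.snd R N L ∘ₗ e.toLinearMap)⟩
    · rintro ⟨ha, hb⟩ f
      have ha' := ha (f ∘ₗ e.symm.toLinearMap ∘ₗ LinearMap.inl R N L)
      have hb' := hb (f ∘ₗ e.symm.toLinearMap ∘ₗ LinearMap.inr R N L)
      have : m = e.symm (LinearMap.inl R N L (e m).1 + LinearMap.inr R N L (e m).2) := by
        simp
      rw [this, map_add, map_add]
      exact (congrArg₂ (· + ·) ha' hb').trans (add_zero 0)
  have h3 : ∀ m, m ∈ charSocle χ M ⊓ charRadical χ M ↔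
      (e m).1 ∈ charSocle χ N ⊓ charRadical χ N ∧
        (e m).2 ∈ charSocle χ L ⊓ charRadical χ L := by
    intro m
    simp only [Submodule.mem_inf, h1, h2]
    tauto
  unfold charMultiplicity
  rw [length_toNat_of_prod R e h1, length_toNat_of_prod R e h3]
  push_cast
  ring

theorem charMultiplicity_eq_zero_of_le {χ : R →+* K} {M : Type*} [AddCommGroup M] [Module R M]
    (h : charSocle χ M ≤ charRadical χ M) : charMultiplicity χ M = 0 := by
  unfold charMultiplicity
  rw [inf_eq_left.mpr h, sub_self]

/-- A socle element not killed by some `f : P → S` gives a nonzero composite `S → P → S`, an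
isomorphism by Schur's lemma. Then `S` splits off `P` and would be projective. -/
theorem charMultiplicity_projective {χ : R →+* K} (hχ : Function.Surjective χ)
    (hS : ¬ Module.Projective R (CharModule χ)) (P : Type*) [AddCommGroup P] [Module R P]
    [Module.Projective R P] : charMultiplicity χ P = 0 := by
  have := CharModule.isSimpleModule hχ
  refine charMultiplicity_eq_zero_of_le fun m hm f => ?_
  by_contra hf
  have hne : f ∘ₗ CharModule.lift χ hm ≠ 0 := by
    intro h
    apply hf
    have := LinearMap.congr_fun h (Submodule.Quotient.mk (p := RingHom.ker χ) 1)
    rwa [LinearMap.comp_apply, CharModule.lift_mk_one] at this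
  let e := LinearEquiv.ofBijective _ (LinearMap.bijective_of_ne_zero hne)
  refine hS (Module.Projective.of_split (CharModule.lift χ hm) (e.symm.toLinearMap ∘ₗ f) ?_)
  ext1
  exact LinearMap.ext fun x => e.symm_apply_apply _

theorem charMultiplicity_self {χ : R →+* K} (hχ : Function.Surjective χ) :
    charMultiplicity χ (CharModule χ) = 1 := by
  have := CharModule.isSimpleModule hχ
  have h1 : charSocle χ (CharModule χ) = ⊤ :=
    eq_top_iff.mpr fun x _ r hr => CharModule.smul_eq_zero hr x
  have h2 : charRadical χ (CharModule χ) = ⊥ :=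
    eq_bot_iff.mpr fun x hx => hx LinearMap.id
  unfold charMultiplicity
  rw [h1, h2, inf_bot_eq, Module.length_bot, Module.length_top, Module.length_eq_one]
  rfl

/-- The element `r` acts as the identity on the simple module of `ψ` but as zero on any `χ`-socle,
so that socle is zero. -/
theorem charMultiplicity_of_separated {χ ψ : R →+* K} {r : R} (hr : χ r = 0)
    (hr' : ψ r = 1) : charMultiplicity χ (CharModule ψ) = 0 := by
  refine charMultiplicity_eq_zero_of_le fun x hx => ?_
  have h1 : (1 - r) • x = 0 := CharModule.smul_eq_zero (by rw [map_sub, map_one, hr', sub_self]) x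
  rw [sub_smul, one_smul, hx r hr, sub_zero] at h1
  rw [h1]
  exact Submodule.zero_mem _

variable [IsArtinianRing R]

/-- The multiplicity of a nonprojective simple module as a direct summand, as a function
on `K₀`. -/
noncomputable def K0.multiplicity {χ : R →+* K} (hχ : Function.Surjective χ)
    (hS : ¬ Module.Projective R (CharModule χ)) : K0 R →+ ℤ :=
  QuotientAddGroup.lift _
    (FreeAbelianGroup.lift fun M : FGModuleCat.{u} R => charMultiplicity χ M) (by
    rw [AddSubgroup.closure_le]
    rintro x (⟨M, M', M'', e⟩ | ⟨P, h⟩)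
    · simp [charMultiplicity_of_prod χ e]
    · simp [charMultiplicity_projective hχ hS P])

theorem K0.multiplicity_mk {χ : R →+* K} (hχ : Function.Surjective χ)
    (hS : ¬ Module.Projective R (CharModule χ)) (M : FGModuleCat.{u} R) :
    K0.multiplicity hχ hS (K0.mk M) = charMultiplicity χ M := by
  simp [K0.multiplicity, K0.mk]

end Multiplicity

/-! ### Split algebras of radical square zero -/

/-- Characters `χ v` of a ring, separated by elements `idem v` summing up to `1`, whose common
kernel has square zero. -/
structure SplitRadicalSquareZero (R K V : Type*) [Ring R] [Field K] [Fintype V] where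
  /-- The characters. -/
  char : V → R →+* K
  /-- The elements dual to the characters. -/
  idem : V → R
  surjective : ∀ v, Function.Surjective (char v)
  char_idem_self : ∀ v, char v (idem v) = 1
  char_idem_of_ne : ∀ v w, v ≠ w → char v (idem w) = 0
  sum_idem : ∑ v, idem v = 1
  mul_eq_zero : ∀ r s, (∀ v, char v r = 0) → (∀ v, char v s = 0) → r * s = 0

namespace SplitRadicalSquareZero

variable {R : Type u} {K V : Type*} [Ring R] [Field K] [Fintype V]
  (D : SplitRadicalSquareZero R K V)

/-- The module `M` is annihilated by the common kernel of the characters. -/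
def Annihilates (M : Type*) [AddCommGroup M] [Module R M] : Prop :=
  ∀ r : R, (∀ v, D.char v r = 0) → ∀ m : M, r • m = 0

/-- The simple modules given by the characters. -/
noncomputable def simple (v : V) : FGModuleCat.{u} R := FGModuleCat.of R (CharModule (D.char v))

variable {D}

theorem Annihilates.of_injective {M N : Type*} [AddCommGroup M] [Module R M] [AddCommGroup N]
    [Module R N] (hN : D.Annihilates N) (f : M →ₗ[R] N) (hf : Function.Injective f) :
    D.Annihilates M := fun r hr m => hf (by rw [map_smul, hN r hr, map_zero])

/-- If `r` is killed by the character at `v`, then `r * D.idem v` is killed by every character: at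
`v` because of `r`, elsewhere because of `D.idem v`. -/
theorem Annihilates.idem_smul_mem {M : Type*} [AddCommGroup M] [Module R M]
    (hM : D.Annihilates M) (v : V) (m : M) : D.idem v • m ∈ charSocle (D.char v) M := by
  intro r hr
  rw [← mul_smul]
  refine hM _ (fun w => ?_) m
  rw [map_mul]
  by_cases h : w = v
  · rw [h, hr, zero_mul]
  · rw [D.char_idem_of_ne w v h, mul_zero]

theorem sum_idem_smul (D : SplitRadicalSquareZero R K V) {M : Type*} [AddCommGroup M] [Module R M]
    (m : M) : ∑ v, D.idem v • m = m := by
  rw [← Finset.sum_smul, D.sum_idem, one_smul]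

/-- Each `m` is the sum of the elements `D.idem v • m`, and each of these lies in the image of a
simple module. -/
theorem Annihilates.isSemisimpleModule {M : Type*} [AddCommGroup M] [Module R M]
    (hM : D.Annihilates M) : IsSemisimpleModule R M := by
  refine isSemisimpleModule_of_isSemisimpleModule_submodule'
    (p := fun x : V × M => LinearMap.range
      (CharModule.lift (D.char x.1) (hM.idem_smul_mem x.1 x.2)))
    (fun x => ?_) ?_
  · have := CharModule.isSimpleModule (D.surjective x.1)
    exact IsSemisimpleModule.range _
  · rw [eq_top_iff]
    rintro m -
    rw [← D.sum_idem_smul m]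
    refine Submodule.sum_mem _ fun v _ => Submodule.mem_iSup_of_mem (v, m)
      ⟨Submodule.Quotient.mk 1, CharModule.lift_mk_one _ _⟩

theorem Annihilates.exists_simple_equiv {M : Type*} [AddCommGroup M] [Module R M]
    (hM : D.Annihilates M) [IsSimpleModule R M] :
    ∃ v, Nonempty (M ≃ₗ[R] CharModule (D.char v)) := by
  have := IsSimpleModule.nontrivial R M
  obtain ⟨m, hm⟩ := exists_ne (0 : M)
  obtain ⟨v, -, hv⟩ := Finset.exists_ne_zero_of_sum_ne_zero (by rwa [D.sum_idem_smul m])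
  have := CharModule.isSimpleModule (D.surjective v)
  refine ⟨v, ⟨(LinearEquiv.ofBijective (CharModule.lift (D.char v) (hM.idem_smul_mem v m))
    (LinearMap.bijective_of_ne_zero fun h => hv ?_)).symm⟩⟩
  rw [← CharModule.lift_mk_one (D.char v) (hM.idem_smul_mem v m), h, LinearMap.zero_apply]

/-- The class in `K₀` of a module annihilated by the common kernel of the characters. -/
theorem Annihilates.exists_mk_eq_sum [IsArtinianRing R] {M : FGModuleCat.{u} R}
    (hM : D.Annihilates M) :
    ∃ c : V → ℕ, K0.mk M = ∑ v, c v • K0.mk (D.simple v) ∧ (Nontrivial M → ∃ v, 0 < c v) := by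
  classical
  -- Induction on the length, splitting off one simple submodule. The positivity clause concerns the
  -- coefficients `c`, not the class: a nonzero module has class zero if it is a sum of projective
  -- simples.
  suffices h : ∀ (n : ℕ) (M : FGModuleCat.{u} R), D.Annihilates M → Module.length R M = n →
      ∃ c : V → ℕ, K0.mk M = ∑ v, c v • K0.mk (D.simple v) ∧ (Nontrivial M → ∃ v, 0 < c v) by
    obtain ⟨n, hn⟩ := ENat.ne_top_iff_exists.mp (Module.length_ne_top (R := R) (M := M))
    exact h n M hM hn.symm
  intro n
  induction n with
  | zero =>
    intro M _ hn
    have : Subsingleton M := Module.length_eq_zero_iff.mp (by exact_mod_cast hn)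
    refine ⟨0, ?_, fun h => absurd h (not_nontrivial M)⟩
    rw [K0.mk_projective M inferInstance]
    simp
  | succ n ih =>
    intro M hM hn
    have := hM.isSemisimpleModule
    have : Nontrivial M := by
      by_contra h
      rw [not_nontrivial_iff_subsingleton] at h
      rw [Module.length_eq_zero_iff.mpr h] at hn
      exact absurd hn.symm (by exact_mod_cast Nat.succ_ne_zero n)
    obtain ⟨S, hS⟩ := IsSemisimpleModule.exists_simple_submodule R M
    obtain ⟨C, hC⟩ := exists_isCompl S
    let e := (Submodule.prodEquivOfIsCompl S C hC).symm
    have hl : Module.length R C = n := by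
      have h1 := e.length_eq
      rw [Module.length_prod, Module.length_eq_one R S, hn, Nat.cast_succ, add_comm] at h1
      exact ENat.add_right_injective_of_ne_top ENat.one_ne_top h1.symm
    obtain ⟨v, ⟨f⟩⟩ := (hM.of_injective S.subtype S.subtype_injective).exists_simple_equiv
    obtain ⟨c, hc, -⟩ := ih (FGModuleCat.of R C)
      (hM.of_injective C.subtype C.subtype_injective) hl
    refine ⟨c + Pi.single v 1, ?_, fun _ => ⟨v, by simp⟩⟩
    rw [K0.mk_sum M (FGModuleCat.of R S) (FGModuleCat.of R C) e, hc,
      K0.mk_equiv (FGModuleCat.of R S) (D.simple v) f]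
    simp [add_smul, Finset.sum_add_distrib, Pi.single_apply, add_comm]

/-- This is where radical square zero enters: the kernel of a projective cover has its coordinates
in the common kernel of the characters, whose square is zero. -/
theorem annihilates_ker {P M : Type u} [AddCommGroup P] [Module R P] [AddCommGroup M]
    [Module R M] {p : P →ₗ[R] M} (hp : IsProjectiveCover p) :
    D.Annihilates (LinearMap.ker p) := by
  rintro r hr ⟨x, hx⟩
  have key : ∀ (f : P →ₗ[R] R) v, D.char v (f x) = 0 := by
    intro f v
    have := CharModule.isSimpleModule (D.surjective v)
    let g : P →ₗ[R] CharModule (D.char v) := (RingHom.ker (D.char v)).mkQ ∘ₗ f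
    suffices h : g x = 0 from (Submodule.Quotient.mk_eq_zero _).mp h
    rcases LinearMap.surjective_or_eq_zero g with hg | hg
    · have hco := LinearMap.isCoatom_ker_of_surjective hg
      by_contra hgx
      -- If `g x ≠ 0`, the maximal submodule `ker g` together with `ker p` is everything;
      -- superfluousness then gives `ker g = ⊤`, a contradiction.
      refine hco.1 (hp.superfluous _ (hco.2 _ (lt_of_le_of_ne le_sup_left fun h => hgx ?_)))
      rw [← LinearMap.mem_ker, h]
      exact (le_sup_right : LinearMap.ker p ≤ _) hx
    · rw [hg, LinearMap.zero_apply]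
  -- The section `s` embeds `P` in a free module, and `key` applies to each coordinate of `s x`.
  obtain ⟨s, hs⟩ := Module.projective_def.mp hp.projective
  apply Subtype.ext
  apply hs.injective
  rw [Submodule.coe_smul, Submodule.coe_zero, map_smul, map_zero]
  ext y
  exact D.mul_eq_zero r _ hr (key (Finsupp.lapply y ∘ₗ s))

/-! ### The syzygy operator as a matrix on the nonprojective simples -/

variable (D)

/-- The vertices whose simple module is not projective. -/
abbrev NonprojectiveVertex : Type _ := {v : V // ¬ Module.Projective R (CharModule (D.char v))}

/-- The homomorphism to `K₀` given by the nonprojective simple modules. -/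
noncomputable def ofVector [Fintype D.NonprojectiveVertex] :
    (D.NonprojectiveVertex → ℤ) →+ K0 R where
  toFun x := ∑ v, x v • K0.mk (D.simple v)
  map_zero' := by simp
  map_add' x y := by simp [add_smul, Finset.sum_add_distrib]

theorem ofVector_apply [Fintype D.NonprojectiveVertex] (x : D.NonprojectiveVertex → ℤ) :
    D.ofVector x = ∑ v, x v • K0.mk (D.simple v) := rfl

variable {D}

theorem sum_mk_simple_eq_ofVector [Fintype D.NonprojectiveVertex] (c : V → ℕ) :
    ∑ v, c v • K0.mk (D.simple v) = D.ofVector fun v => (c v : ℤ) := by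
  classical
  rw [ofVector_apply]
  simp only [natCast_zsmul]
  symm
  have h := Finset.sum_subtype_of_mem (p := fun v => ¬ Module.Projective R (CharModule (D.char v)))
    (s := Finset.univ.filter fun v => ¬ Module.Projective R (CharModule (D.char v)))
    (fun v => c v • K0.mk (D.simple v)) (by simp)
  have h2 : (Finset.univ.filter fun v => ¬ Module.Projective R (CharModule (D.char v))).subtype
      (fun v => ¬ Module.Projective R (CharModule (D.char v))) = Finset.univ := by
    ext v; simpa using v.2
  rw [h2] at h
  convert h.trans ?_ using 2
  refine Finset.sum_subset (Finset.subset_univ _) fun v _ hv => ?_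
  have hproj : Module.Projective R (CharModule (D.char v)) := by simpa using hv
  rw [K0.mk_projective (D.simple v) hproj, smul_zero]

variable [IsArtinianRing R]

/-- The multiplicity functionals form a dual family to the classes of the nonprojective simples. -/
theorem ofVector_injective (D : SplitRadicalSquareZero R K V) [Fintype D.NonprojectiveVertex] :
    Function.Injective D.ofVector := by
  classical
  rw [injective_iff_map_eq_zero]
  intro x hx
  funext v
  have h := congrArg (K0.multiplicity (D.surjective v) v.2) hx
  rw [ofVector_apply, map_sum, map_zero, Finset.sum_eq_single v] at h
  · rw [map_zsmul, K0.multiplicity_mk] at h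
    erw [charMultiplicity_self (D.surjective v)] at h
    simpa using h
  · intro w _ hw
    rw [map_zsmul, K0.multiplicity_mk]
    erw [charMultiplicity_of_separated (r := D.idem w)
      (D.char_idem_of_ne v w fun h => hw (Subtype.ext h.symm)) (D.char_idem_self w)]
    exact smul_zero _
  · simp

theorem annihilates_syzygy (M : FGModuleCat.{u} R) : D.Annihilates (syzygy M) :=
  annihilates_ker (exists_isProjectiveCover M).choose_spec.choose_spec

theorem nontrivial_syzygy {M : FGModuleCat.{u} R} (hM : ¬ Module.Projective R M) :
    Nontrivial (syzygy M) := by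
  have hc := (exists_isProjectiveCover M).choose_spec.choose_spec
  have := hc.projective
  by_contra h
  have h' : Subsingleton (LinearMap.ker (exists_isProjectiveCover M).choose_spec.choose) :=
    not_nontrivial_iff_subsingleton.mp h
  rw [Submodule.subsingleton_iff_eq_bot, LinearMap.ker_eq_bot] at h'
  exact hM (Module.Projective.of_equiv (LinearEquiv.ofBijective _ ⟨h', hc.surjective⟩))

theorem Annihilates.mk_mem_range_ofVector [Fintype D.NonprojectiveVertex] {M : FGModuleCat.{u} R}
    (hM : D.Annihilates M) : K0.mk M ∈ D.ofVector.range := by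
  obtain ⟨c, hc, -⟩ := hM.exists_mk_eq_sum
  exact ⟨_, (hc.trans (sum_mk_simple_eq_ofVector c)).symm⟩

theorem omegaBar_mem_range_ofVector [Fintype D.NonprojectiveVertex] (x : K0 R) :
    omegaBar R x ∈ D.ofVector.range := by
  obtain ⟨y, rfl⟩ := QuotientAddGroup.mk_surjective x
  induction y using FreeAbelianGroup.induction_on with
  | zero =>
    rw [QuotientAddGroup.mk_zero, map_zero]
    exact zero_mem _
  | of M =>
    have h := (D.annihilates_syzygy M).mk_mem_range_ofVector
    rwa [← omegaBar_mk] at h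
  | neg M h =>
    rw [QuotientAddGroup.mk_neg, map_neg]
    exact neg_mem h
  | add a b ha hb =>
    rw [QuotientAddGroup.mk_add, map_add]
    exact add_mem ha hb

/-- Row `v` of `C` lists the multiplicities of the nonprojective simples in the syzygy of the simple
at `v`. -/
theorem exists_omegaBar_matrix [Fintype D.NonprojectiveVertex] :
    ∃ C : Matrix D.NonprojectiveVertex D.NonprojectiveVertex ℤ,
      (∀ x, omegaBar R (D.ofVector x) = D.ofVector (Matrix.vecMul x C)) ∧
      (Fintype.card D.NonprojectiveVertex = Fintype.card V →
        (∀ v w, 0 ≤ C v w) ∧ ∀ v, ∃ w, 0 < C v w) := by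
  choose c hc hpos using fun v => (D.annihilates_syzygy (D.simple v)).exists_mk_eq_sum
  refine ⟨fun v w => (c v w : ℤ), fun x => ?_, fun hcard => ⟨fun v w => Int.natCast_nonneg _,
    fun v => ?_⟩⟩
  · have h : Matrix.vecMul x (fun v w : D.NonprojectiveVertex => (c v w : ℤ))
        = ∑ v, x v • fun w : D.NonprojectiveVertex => (c v w : ℤ) := by
      ext w
      simp [Matrix.vecMul, dotProduct]
    rw [ofVector_apply, map_sum, h, map_sum]
    refine Finset.sum_congr rfl fun v _ => ?_
    rw [map_zsmul, map_zsmul, omegaBar_mk, hc, sum_mk_simple_eq_ofVector]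
  -- The nonzero syzygy has a simple constituent `w`. Its column could be missing from `C` if that
  -- simple were projective; equality of the cardinalities excludes this.
  · obtain ⟨w, hw⟩ := hpos v (nontrivial_syzygy v.2)
    have hbij : Function.Bijective (Subtype.val : D.NonprojectiveVertex → V) :=
      (Fintype.bijective_iff_injective_and_card _).mpr ⟨Subtype.val_injective, hcard⟩
    obtain ⟨w, rfl⟩ := hbij.2 w
    exact ⟨w, Int.natCast_pos.mpr hw⟩

/-- The operator `Ω̄` is injective on the image under `Ω̄ ^ k` of the group generated by the classes
of the simple modules, if `k + 1` is at least their number. -/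
theorem injOn_omegaBar [Nonempty V] [Fintype D.NonprojectiveVertex] {k : ℕ}
    (hk : Fintype.card V - 1 ≤ k) :
    Set.InjOn (omegaBar R) ((omegaBar R)^[k] '' (D.ofVector.range : Set (K0 R))) := by
  obtain ⟨C, hC, hpos⟩ := D.exists_omegaBar_matrix
  have hn : Fintype.card V - 1 + 1 = Fintype.card V := Nat.succ_pred_eq_of_pos Fintype.card_pos
  have hsub : Fintype.card D.NonprojectiveVertex ≤ Fintype.card V :=
    Fintype.card_le_of_injective _ Subtype.val_injective
  have hiter : ∀ k x, (omegaBar R)^[k] (D.ofVector x)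
      = D.ofVector ((fun y => Matrix.vecMul y C)^[k] x) := fun k x =>
    ((Function.Semiconj.iterate_right (f := D.ofVector) (ga := fun y => Matrix.vecMul y C)
      (gb := omegaBar R) (fun x => (hC x).symm) k).eq x).symm
  -- By additivity, injectivity says that `x - y` is killed by the `k`-th iterate of `C` as soon as
  -- it is killed by the next one.
  rintro _ ⟨_, ⟨x, rfl⟩, rfl⟩ _ ⟨_, ⟨y, rfl⟩, rfl⟩ hxy
  rw [← sub_eq_zero, ← iterate_map_sub, ← map_sub, hiter]
  rw [← sub_eq_zero, ← map_sub, ← iterate_map_sub, ← Function.iterate_succ_apply' (omegaBar R),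
    ← map_sub, hiter, map_eq_zero_iff _ D.ofVector_injective] at hxy
  rw [Matrix.iterate_vecMul_eq_zero (by rwa [hn]) (by rwa [hn]) hk hxy, map_zero]

theorem Annihilates.igusaTodorovPhi_le [Nonempty V] {M : FGModuleCat.{u} R}
    (hM : D.Annihilates M) : igusaTodorovPhi M ≤ ((Fintype.card V - 1 : ℕ) : ℕ∞) := by
  classical
  have : Fintype D.NonprojectiveVertex := Fintype.ofFinite _
  -- The direct summands of `M` are again killed by the radical, so `⟨add M⟩` lies in the span of
  -- the simples.
  refine iInf₂_le _ fun s => (D.injOn_omegaBar (Nat.le_add_right _ s)).mono (Set.image_mono ?_)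
  refine (AddSubgroup.closure_le _).mpr ?_
  rintro _ ⟨N, -, ⟨N', ⟨e⟩⟩, rfl⟩
  refine (hM.of_injective (e.symm.toLinearMap ∘ₗ LinearMap.inl R N N') ?_).mk_mem_range_ofVector
  exact e.symm.injective.comp LinearMap.inl_injective

/-- One application of `Ω̄` moves `⟨add M⟩` into the span of the simples, after which the exponent
`Fintype.card V - 1` suffices. -/
theorem igusaTodorovPhi_le_card (D : SplitRadicalSquareZero R K V) [Nonempty V]
    (M : FGModuleCat.{u} R) : igusaTodorovPhi M ≤ (Fintype.card V : ℕ∞) := by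
  classical
  have : Fintype D.NonprojectiveVertex := Fintype.ofFinite _
  refine iInf₂_le _ fun s => (D.injOn_omegaBar (k := Fintype.card V - 1 + s)
    (Nat.le_add_right _ s)).mono ?_
  have hn : Fintype.card V + s = Fintype.card V - 1 + s + 1 := by
    have : 0 < Fintype.card V := Fintype.card_pos
    omega
  rintro _ ⟨x, -, rfl⟩
  exact ⟨omegaBar R x, D.omegaBar_mem_range_ofVector x,
    by rw [hn, Function.iterate_succ_apply]⟩

end SplitRadicalSquareZero

/-! ### The characters of a path algebra modulo the square of the arrow ideal -/

namespace PathAlgebra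

variable {K : Type*} {V : Type*} [Field K] [Quiver V]

/-- The coefficient of an element of the path algebra at the path of length zero at `v`. -/
noncomputable def nilCoeff (v : V) : PathAlgebra K V →ₗ[K] K :=
  Finsupp.lapply (⟨v, v, Quiver.Path.nil⟩ : QuiverPath V)

theorem nilCoeff_ofPath_nil_self (v : V) :
    nilCoeff v (ofPath K (Quiver.Path.nil : Quiver.Path v v)) = 1 :=
  Finsupp.single_eq_same

theorem nilCoeff_ofPath_nil_of_ne {v w : V} (h : v ≠ w) :
    nilCoeff v (ofPath K (Quiver.Path.nil : Quiver.Path w w)) = 0 :=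
  Finsupp.single_eq_of_ne fun h' => h (congrArg Sigma.fst h')

theorem nilCoeff_ofPath_cons (v : V) {i j k : V} (p : Quiver.Path i j) (α : j ⟶ k) :
    nilCoeff v (ofPath K (p.cons α)) = 0 := by
  refine Finsupp.single_eq_of_ne fun h => ?_
  obtain rfl : v = i := congrArg Sigma.fst h
  have h1 := eq_of_heq (Sigma.mk.inj h).2
  obtain rfl : v = k := congrArg Sigma.fst h1
  have h2 := eq_of_heq (Sigma.mk.inj h1).2
  exact Quiver.Path.nil_ne_cons p α h2

/-- A product of two paths is the trivial path at `v` only if both factors are. -/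
theorem nilCoeff_mul (v : V) (a b : PathAlgebra K V) :
    nilCoeff v (a * b) = nilCoeff v a * nilCoeff v b := by
  induction a using induction_on with
  | zero => rw [zero_mul', map_zero, zero_mul]
  | add x y hx hy => rw [add_mul', map_add, hx, hy, map_add, add_mul]
  | smul r x hx => rw [smul_mul', map_smul, hx, map_smul, smul_mul_assoc]
  | @path i j p =>
  induction b using induction_on with
  | zero => rw [mul_zero', map_zero, mul_zero]
  | add x y hx hy => rw [mul_add', map_add, hx, hy, map_add, mul_add]
  | smul r x hx => rw [mul_smul', map_smul, hx, map_smul, mul_smul_comm]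
  | @path k l q =>
  by_cases h : k = j
  · subst h
    rw [ofPath_mul_ofPath]
    cases q with
    | cons q α => rw [Quiver.Path.comp_cons, nilCoeff_ofPath_cons, nilCoeff_ofPath_cons, mul_zero]
    | nil =>
      rw [Quiver.Path.comp_nil]
      cases p with
      | cons p α => rw [nilCoeff_ofPath_cons, zero_mul]
      | nil =>
        by_cases hv : v = i
        · subst hv
          rw [nilCoeff_ofPath_nil_self, one_mul]
        · rw [nilCoeff_ofPath_nil_of_ne hv, zero_mul]
  · rw [ofPath_mul_ofPath_of_ne _ _ h, map_zero]
    cases p with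
    | cons p α => rw [nilCoeff_ofPath_cons, zero_mul]
    | nil =>
      cases q with
      | cons q α => rw [nilCoeff_ofPath_cons, mul_zero]
      | nil =>
        by_cases hv : v = i
        · subst hv
          rw [nilCoeff_ofPath_nil_of_ne (Ne.symm h), mul_zero]
        · rw [nilCoeff_ofPath_nil_of_ne hv, zero_mul]

variable [Fintype V]

theorem nilCoeff_one (v : V) : nilCoeff v (1 : PathAlgebra K V) = 1 := by
  rw [one_def, map_sum, Finset.sum_eq_single v, nilCoeff_ofPath_nil_self]
  · intro w _ hw
    exact nilCoeff_ofPath_nil_of_ne hw.symm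
  · simp

/-- The coefficient at a path of length zero as a character of the path algebra. -/
noncomputable def nilChar (v : V) : PathAlgebra K V →+* K :=
  { (nilCoeff v).toAddMonoidHom with
    map_one' := nilCoeff_one v
    map_mul' := nilCoeff_mul v }

theorem nilChar_apply (v : V) (a : PathAlgebra K V) : nilChar v a = nilCoeff v a := rfl

theorem nilChar_surjective (v : V) : Function.Surjective (nilChar (K := K) v) := fun c =>
  ⟨c • 1, by rw [nilChar_apply, map_smul, nilCoeff_one, smul_eq_mul, mul_one]⟩

theorem nilChar_eq_zero_of_mem {a : PathAlgebra K V} (ha : a ∈ arrowIdeal K V) (v : V) :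
    nilChar v a = 0 := by
  have h : TwoSidedIdeal.span {x : PathAlgebra K V | ∃ (i j : V) (α : i ⟶ j),
      x = ofPath K α.toPath} ≤ TwoSidedIdeal.ker (nilChar (K := K) v) := by
    rw [TwoSidedIdeal.span_le]
    rintro _ ⟨i, j, α, rfl⟩
    exact (TwoSidedIdeal.mem_ker _).mpr (nilCoeff_ofPath_cons v Quiver.Path.nil α)
  exact (TwoSidedIdeal.mem_ker _).mp (h (TwoSidedIdeal.mem_asIdeal.mp ha))

theorem mem_arrowIdeal_of_nilChar_eq_zero {a : PathAlgebra K V} (ha : ∀ v, nilChar v a = 0) :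
    a ∈ arrowIdeal K V := by
  -- Vanishing of the characters does not pass to the summands of `a`; subtracting the trivial part
  -- gives a claim linear in `a`, which can be checked on paths.
  suffices h : a - ∑ v, nilCoeff v a • ofPath K (Quiver.Path.nil : Quiver.Path v v)
      ∈ arrowIdeal K V by
    simpa [fun v => show nilCoeff v a = 0 from ha v] using h
  clear ha
  induction a using induction_on with
  | zero => simp
  | add x y hx hy =>
    simp only [map_add, add_smul, Finset.sum_add_distrib, add_sub_add_comm]
    exact add_mem hx hy
  | smul c x hx =>
    simp only [map_smul, smul_assoc, ← Finset.smul_sum, ← smul_sub]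
    exact Submodule.smul_of_tower_mem _ c hx
  | @path i j p =>
    cases p with
    | cons p α => simpa [nilCoeff_ofPath_cons] using ofPath_cons_mem_arrowIdeal p α
    | nil =>
      rw [Finset.sum_eq_single i]
      · simp [nilCoeff_ofPath_nil_self]
      · intro w _ hw
        rw [nilCoeff_ofPath_nil_of_ne hw, zero_smul]
      · simp

end PathAlgebra

namespace RadSquareZero

open PathAlgebra

variable {K : Type*} {V : Type*} [Field K] [Quiver V] [Fintype V]

/-- The character of `K V / J ^ 2` given by a vertex. -/
noncomputable def vertexChar (v : V) : RadSquareZero K V →+* K :=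
  Ideal.Quotient.lift (arrowIdeal K V ^ 2) (nilChar v) fun _ ha =>
    nilChar_eq_zero_of_mem (Ideal.pow_le_self two_ne_zero ha) v

theorem vertexChar_mk (v : V) (a : PathAlgebra K V) :
    vertexChar v (Ideal.Quotient.mk (arrowIdeal K V ^ 2) a) = nilChar v a := rfl

theorem mul_eq_zero_of_vertexChar {x y : RadSquareZero K V} (hx : ∀ v, vertexChar v x = 0)
    (hy : ∀ v, vertexChar v y = 0) : x * y = 0 := by
  obtain ⟨a, rfl⟩ := Ideal.Quotient.mk_surjective x
  obtain ⟨b, rfl⟩ := Ideal.Quotient.mk_surjective y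
  rw [← map_mul, Ideal.Quotient.eq_zero_iff_mem, Submodule.pow_succ, Submodule.pow_one]
  exact Ideal.mul_mem_mul (mem_arrowIdeal_of_nilChar_eq_zero hx)
    (mem_arrowIdeal_of_nilChar_eq_zero hy)

variable {A : Type*} [Ring A] [Algebra K A]

/-- The characters of the opposite of an algebra isomorphic to `K V / J ^ 2`. -/
noncomputable def splitData (e : A ≃ₐ[K] RadSquareZero K V) :
    SplitRadicalSquareZero Aᵐᵒᵖ K V where
  char v := ((vertexChar v).comp (e : A →+* RadSquareZero K V)).fromOpposite
    fun _ _ => Commute.all _ _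
  idem v := MulOpposite.op
    (e.symm (Ideal.Quotient.mk _ (ofPath K (Quiver.Path.nil : Quiver.Path v v))))
  surjective v c := by
    obtain ⟨a, rfl⟩ := nilChar_surjective v c
    refine ⟨MulOpposite.op (e.symm (Ideal.Quotient.mk _ a)), ?_⟩
    exact congrArg (vertexChar v) (e.apply_symm_apply _)
  char_idem_self v :=
    (congrArg (vertexChar v) (e.apply_symm_apply _)).trans (nilCoeff_ofPath_nil_self v)
  char_idem_of_ne v w h :=
    (congrArg (vertexChar v) (e.apply_symm_apply _)).trans (nilCoeff_ofPath_nil_of_ne h)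
  sum_idem := by
    refine (map_sum (MulOpposite.opAddEquiv (α := A)) _ _).symm.trans ?_
    rw [← map_sum, ← map_sum, ← one_def, map_one, map_one]
    rfl
  mul_eq_zero r s hr hs := by
    apply MulOpposite.unop_injective
    apply e.injective
    rw [MulOpposite.unop_mul, map_mul, MulOpposite.unop_zero, map_zero]
    -- The factors are swapped because the product is taken in the opposite ring.
    exact mul_eq_zero_of_vertexChar hs hr

theorem splitData_char (e : A ≃ₐ[K] RadSquareZero K V) (v : V) (r : Aᵐᵒᵖ) :
    (splitData e).char v r = vertexChar v (e r.unop) := rfl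

end RadSquareZero

/-! ### The module `A₀` and the two bounds -/

theorem annihilates_semisimpleModule {K : Type*} {V : Type*} [Field K] [Quiver V] [Fintype V]
    {A : Type u} [Ring A] [Algebra K A] (e : A ≃ₐ[K] RadSquareZero K V) :
    (RadSquareZero.splitData e).Annihilates (semisimpleModule e) := by
  intro r hr m
  -- An element killed by all vertex characters lifts to an element of the arrow ideal, so it dies
  -- in `K V / J`.
  have hker : r ∈ RingHom.ker (projToVertices e).op := by
    rw [RingHom.mem_ker]
    apply MulOpposite.unop_injective
    obtain ⟨a, ha⟩ := Ideal.Quotient.mk_surjective (e r.unop)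
    have h : projToVertices e r.unop = Ideal.Quotient.mk (arrowIdeal K V) a := by
      change Ideal.Quotient.factor (Ideal.pow_le_self two_ne_zero) (e r.unop) = _
      rw [← ha, Ideal.Quotient.factor_mk]
    refine h.trans (Ideal.Quotient.eq_zero_iff_mem.mpr
      (PathAlgebra.mem_arrowIdeal_of_nilChar_eq_zero fun v => ?_))
    have := hr v
    rwa [RadSquareZero.splitData_char, ← ha, RadSquareZero.vertexChar_mk] at this
  obtain ⟨s, rfl⟩ := Submodule.Quotient.mk_surjective _ m
  refine (Submodule.Quotient.mk_smul _ r s).symm.trans ((Submodule.Quotient.mk_eq_zero _).mpr ?_)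
  rw [RingHom.mem_ker] at hker ⊢
  rw [smul_eq_mul, map_mul, hker, zero_mul]

theorem corollary4p14 {K : Type*} [Field K] {V : Type*} [Fintype V] [Nonempty V] [Quiver V]
    [∀ i j : V, Finite (i ⟶ j)] {A : Type u} [Ring A] [Algebra K A]
    (e : A ≃ₐ[K] RadSquareZero K V) :
    haveI : IsArtinianRing Aᵐᵒᵖ := isArtinianRing_op_of_equiv e
    igusaTodorovPhi (semisimpleModule e) ≤ ((Fintype.card V - 1 : ℕ) : ℕ∞) ∧
      phiDim Aᵐᵒᵖ ≤ (Fintype.card V : ℕ∞) := by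
  have : IsArtinianRing Aᵐᵒᵖ := isArtinianRing_op_of_equiv e
  exact ⟨(annihilates_semisimpleModule e).igusaTodorovPhi_le,
    iSup_le fun M => (RadSquareZero.splitData e).igusaTodorovPhi_le_card M⟩
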